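/- A *-continuous Kleene algebra is an idempotent semiring $K=(K,\oplus,\otimes,0,1)$, ordered by $x\le y\iff x\oplus y=y$, with an operation ${}^*$ such that for all $x,y,z\in K$ the infinite sum $\bigoplus_{n\ge 0}xy^nz$ (the least upper bound) exists and equals $xy^*z$; in particular $y^*=\bigoplus_{n\ge 0}y^n$. A $K$-weighted automaton $\mathcal S=(S,I,F,T)$ consists of a finite set $S$ of states, sets $I,F\subseteq S$ of initial and accepting states, and a finite set $T\subseteq S\times K\times S$ of transitions. A finite path is a finite, possibly empty, sequence of consecutive transitions from some state to some state. Its weight is the product of its transition weights in order (the empty path at a state has weight $1$), and it is accepting if it leads from a state in $I$ to a state in $F$. The reachability value $|\mathcal S|$ is the sum (least upper bound) in $K$ of the weights of all accepting finite paths, if it exists. The transition matrix $M\in K^{S\times S}$ of $\mathcal S$ is $M_{ij}=\bigoplus\{x\mid (i,x,j)\in T\}$, and $\alpha,\kappa\in\{0,1\}^S$ are the indicator vectors of $I$ and $F$. The star of $M$ is $M^*=\bigoplus_{m\ge 0}M^m$, entrywise. Let $N$ be a set of features and $px\subseteq 2^N$ a set of products. Feature guards are Boolean expressions over $N$, where two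 expressions are identified if they are satisfied by the same products in $px$; write $[\![\gamma]\!]=\{p\in px\mid p\models\gamma\}$. A guard partition is a finite set $P$ of guards with $[\![\bigvee P]\!]=px$, $[\![\gamma]\!]\neq\emptyset$ for all $\gamma\in P$, and $[\![\gamma_1]\!]\cap[\![\gamma_2]\!]=\emptyset$ for distinct $\gamma_1,\gamma_2\in P$. Let $GP\,K$ be the set of all injective functions $f:P\to K$ whose domain $P$ is a guard partition. For $p\in px$, put $[\![f]\!](p)=f(\gamma)$, where $\gamma$ is the unique guard in $P$ with $p\models\gamma$. The canonicalization of an arbitrary function $f:P\to K$ on a guard partition is the element of $GP\,K$ obtained by replacing each class of guards in $P$ on which $f$ takes the same value by its disjunction, with that value. For $f_1:P_1\to K$ and $f_2:P_2\to K$ in $GP\,K$, the elements $f_1\oplus f_2$ and $f_1\otimes f_2$ are the canonicalizations of $\gamma_1\wedge\gamma_2\mapsto f_1(\gamma_1)\oplus f_2(\gamma_2)$ and $\gamma_1\wedge\gamma_2\mapsto f_1(\gamma_1)\otimes f_2(\gamma_2)$ on the guard partition $\{\gamma_1\wedge\gamma_2\mid\gamma_i\in P_i,\ [\![\gamma_1\wedge\gamma_2]\!]\ne\emptyset\}$,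 and $f_1^*$ is the canonicalization of $\gamma\mapsto f_1(\gamma)^*$. With these operations, and the constant functions $0,1$ on the partition $\{\mathrm{true}\}$, $GP\,K$ is a *-continuous Kleene algebra. A featured weighted automaton over $K$ and $px$ is a $GP\,K$-weighted automaton $\mathcal F=(S,I,F,T)$. Its projection to $p\in px$ is the $K$-weighted automaton $\mathrm{proj}_p(\mathcal F)=(S,I,F,\{(s,[\![f]\!](p),s')\mid(s,f,s')\in T\})$. **Theorem 1.** Let $K$ be a *-continuous Kleene algebra and $\mathcal F$ a featured weighted automaton over $K$ and $px$, with transition matrix $M$ over $GP\,K$ and indicator vectors $\alpha,\kappa$ over $GP\,K$. Then $M^*$ exists over $GP\,K$, and $|\mathcal F|:=\alpha M^*\kappa\in GP\,K$ is the reachability value of $\mathcal F$ as a $GP\,K$-weighted automaton. For every product $p\in px$ the reachability value $|\mathrm{proj}_p(\mathcal F)|$ exists in $K$ and $$|\mathrm{proj}_p(\mathcal F)|=[\![\,|\mathcal F|\,]\!](p).$$ So the single element $|\mathcal F|$ gives the reachability values for all products at once. -/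

import Mathlib

open scoped Matrix

noncomputable section

namespace FWA

/-! ## Kleene algebras, matrix star -/

/-- A `*`-continuous Kleene algebra: an idempotent semiring, with its natural order
`x ≤ y ↔ x + y = y`, in which all sums `⨁ₙ x yⁿ z` exist (an infinite sum is a least upper
bound) and equal `x y* z`. For `x = z = 1` this says `y* = ⨁ₙ yⁿ`. -/
class StarContinuousKleeneAlgebra (K : Type*) extends IdemSemiring K, KStar K where
  isLUB_mul_kstar_mul : ∀ x y z : K,
    IsLUB (Set.range fun n : ℕ => x * y ^ n * z) (x * KStar.kstar y * z)

/-- `N` is the star `⨁ₘ M ^ m` of the square matrix `M`. -/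
def IsMatrixStar {S A : Type*} [Fintype S] [DecidableEq S] [IdemSemiring A]
    (M N : Matrix S S A) : Prop :=
  ∀ i j, IsLUB (Set.range fun m : ℕ => (M ^ m) i j) (N i j)

/-! ## Weighted automata -/

/-- An automaton with set of states `S` and weights in `K`. -/
structure WeightedAutomaton (S K : Type*) where
  /-- initial states -/
  init : Set S
  /-- accepting states -/
  acc : Set S
  /-- the finite set of transitions -/
  trans : Finset (S × K × S)

namespace WeightedAutomaton

variable {S K : Type*}

/-- `A.IsPath s π s'`: the list `π` of consecutive transitions is a finite path of `A`
from `s` to `s'`. -/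
inductive IsPath (A : WeightedAutomaton S K) : S → List (S × K × S) → S → Prop
  | nil (s : S) : IsPath A s [] s
  | cons {s s' s'' : S} {x : K} {π : List (S × K × S)} :
      (s, x, s') ∈ A.trans → IsPath A s' π s'' → IsPath A s ((s, x, s') :: π) s''

/-- The weight of a path: the product, in order, of the weights of its transitions. -/
def weight [Semiring K] (π : List (S × K × S)) : K :=
  (π.map fun t => t.2.1).prod

/-- The weights of the accepting finite paths. -/
def acceptingWeights [Semiring K] (A : WeightedAutomaton S K) : Set K :=
  {w | ∃ s ∈ A.init, ∃ s' ∈ A.acc, ∃ π, A.IsPath s π s' ∧ weight π = w}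

/-- The reachability value of `A` exists and is `v`. -/
def IsReachabilityValue [IdemSemiring K] (A : WeightedAutomaton S K) (v : K) : Prop :=
  IsLUB A.acceptingWeights v

open Classical in
/-- The initial vector `α`. -/
def initVec [Semiring K] (A : WeightedAutomaton S K) : S → K :=
  fun i => if i ∈ A.init then 1 else 0

open Classical in
/-- The final vector `κ`. -/
def accVec [Semiring K] (A : WeightedAutomaton S K) : S → K :=
  fun i => if i ∈ A.acc then 1 else 0

open Classical in
/-- The transition matrix, `M i j = ⨁ {x | (i, x, j) ∈ T}`. -/
def matrix [Semiring K] (A : WeightedAutomaton S K) : Matrix S S K :=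
  fun i j => ∑ t ∈ A.trans with t.1 = i ∧ t.2.2 = j, t.2.1

/-- The star `M*` of the transition matrix exists, and `v = α M* κ`. -/
def IsMatrixValue [Fintype S] [DecidableEq S] [IdemSemiring K]
    (A : WeightedAutomaton S K) (v : K) : Prop :=
  ∃ Mstar : Matrix S S K, IsMatrixStar A.matrix Mstar ∧ v = A.initVec ⬝ᵥ (Mstar *ᵥ A.accVec)

open Classical in
/-- Relabel all transitions along `g`. -/
def map {L : Type*} (g : K → L) (A : WeightedAutomaton S K) : WeightedAutomaton S L where
  init := A.init
  acc := A.acc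
  trans := A.trans.image fun t => (t.1, g t.2.1, t.2.2)

end WeightedAutomaton

/-! ## Feature guards -/

/-- Boolean expressions over the features `N`. -/
inductive BoolExpr (N : Type*)
  | tt : BoolExpr N
  | ff : BoolExpr N
  | var : N → BoolExpr N
  | neg : BoolExpr N → BoolExpr N
  | and : BoolExpr N → BoolExpr N → BoolExpr N
  | or : BoolExpr N → BoolExpr N → BoolExpr N

/-- The set of features `p` satisfies the expression. -/
def BoolExpr.Sat {N : Type*} (p : Set N) : BoolExpr N → Prop
  | .tt => True
  | .ff => False
  | .var a => a ∈ p
  | .neg γ => ¬ γ.Sat p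
  | .and γ δ => γ.Sat p ∧ δ.Sat p
  | .or γ δ => γ.Sat p ∨ δ.Sat p

variable {N : Type*} (px : Set (Set N))

/-- Two expressions are equivalent if the same products in `px` satisfy them. -/
def guardSetoid : Setoid (BoolExpr N) where
  r γ δ := ∀ p ∈ px, γ.Sat p ↔ δ.Sat p
  iseqv := ⟨fun _ _ _ => Iff.rfl, fun h p hp => (h p hp).symm,
    fun h h' p hp => (h p hp).trans (h' p hp)⟩

/-- Feature guards: Boolean expressions up to equivalence over the products `px`. -/
def Guard : Type _ := Quotient (guardSetoid px)

variable {px}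

namespace Guard

/-- The set of products that satisfy the guard. -/
def sem (γ : Guard px) : Set px :=
  Quotient.lift (fun (e : BoolExpr N) => {p : px | e.Sat p.1})
    (fun e e' (h : ∀ p ∈ px, e.Sat p ↔ e'.Sat p) => Set.ext fun p => h p.1 p.2) γ

theorem sem_injective : Function.Injective (sem : Guard px → Set px) := by
  intro γ δ
  induction γ using Quotient.inductionOn with | _ a
  induction δ using Quotient.inductionOn with | _ b
  intro h
  exact Quotient.sound fun p hp => Set.ext_iff.1 h ⟨p, hp⟩

/-- The guard `true`. -/
instance : Top (Guard px) := ⟨Quotient.mk _ .tt⟩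

/-- Conjunction of guards. -/
instance : Min (Guard px) :=
  ⟨Quotient.map₂ .and fun _ _ h _ _ h' p hp => and_congr (h p hp) (h' p hp)⟩

/-- Disjunction of guards. -/
protected def or : Guard px → Guard px → Guard px :=
  Quotient.map₂ .or fun _ _ h _ _ h' p hp => or_congr (h p hp) (h' p hp)

theorem sem_top : (⊤ : Guard px).sem = Set.univ := Set.eq_univ_of_forall fun _ => trivial

theorem sem_inf (γ δ : Guard px) : (γ ⊓ δ).sem = γ.sem ∩ δ.sem := by
  induction γ using Quotient.inductionOn
  induction δ using Quotient.inductionOn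
  rfl

theorem sem_or (γ δ : Guard px) : (γ.or δ).sem = γ.sem ∪ δ.sem := by
  induction γ using Quotient.inductionOn
  induction δ using Quotient.inductionOn
  rfl

/-- `γ ≤ δ` iff every product satisfying `γ` satisfies `δ`; joins are disjunctions. -/
instance : SemilatticeSup (Guard px) where
  le γ δ := γ.sem ⊆ δ.sem
  le_refl _ := subset_rfl
  le_trans _ _ _ := Set.Subset.trans
  le_antisymm _ _ h h' := sem_injective (h.antisymm h')
  sup := Guard.or
  le_sup_left γ δ := by rw [sem_or]; exact Set.subset_union_left
  le_sup_right γ δ := by rw [sem_or]; exact Set.subset_union_right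
  sup_le γ δ ε h h' := by rw [sem_or]; exact Set.union_subset h h'

/-- The guard `false` is the empty disjunction. -/
instance : OrderBot (Guard px) where
  bot := Quotient.mk _ .ff
  bot_le _ := fun _ h => False.elim h

theorem sem_bot : (⊥ : Guard px).sem = ∅ := Set.eq_empty_of_forall_notMem fun _ h => h

theorem sem_sup (γ δ : Guard px) : (γ ⊔ δ).sem = γ.sem ∪ δ.sem := sem_or γ δ

theorem mem_sem_finsetSup {ι : Type*} (s : Finset ι) (f : ι → Guard px) (p : px) :
    p ∈ (s.sup f).sem ↔ ∃ i ∈ s, p ∈ (f i).sem := by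
  classical
  induction s using Finset.induction_on with
  | empty => simp [sem_bot]
  | insert a s _ ih =>
    rw [Finset.sup_insert, sem_sup, Set.mem_union, ih]
    simp

end Guard

/-! ## Guard partitions -/

variable (px) in
/-- A guard partition of `px`: a finite set of guards that are satisfiable in `px` and
pairwise disjoint, and whose disjunction holds for all products. -/
structure GuardPartition where
  parts : Finset (Guard px)
  sem_sup_eq : (parts.sup id).sem = Set.univ
  sem_nonempty : ∀ γ ∈ parts, γ.sem.Nonempty
  sem_inter_eq : ∀ γ₁ ∈ parts, ∀ γ₂ ∈ parts, γ₁ ≠ γ₂ → γ₁.sem ∩ γ₂.sem = ∅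

namespace GuardPartition

theorem existsUnique (P : GuardPartition px) (p : px) :
    ∃! γ : {γ // γ ∈ P.parts}, p ∈ γ.1.sem := by
  obtain ⟨γ, hγ, hp⟩ := (Guard.mem_sem_finsetSup _ _ p).1 (P.sem_sup_eq ▸ Set.mem_univ p)
  refine ⟨⟨γ, hγ⟩, hp, fun δ hδ => Subtype.ext ?_⟩
  by_contra hne
  exact Set.notMem_empty p (P.sem_inter_eq _ δ.2 _ hγ hne ▸ ⟨hδ, hp⟩)

/-- The unique guard in `P` that `p` satisfies. -/
def guardOf (P : GuardPartition px) (p : px) : {γ // γ ∈ P.parts} :=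
  (P.existsUnique p).choose

theorem mem_guardOf (P : GuardPartition px) (p : px) : p ∈ (P.guardOf p).1.sem :=
  (P.existsUnique p).choose_spec.1

theorem eq_guardOf (P : GuardPartition px) {p : px} {γ : {γ // γ ∈ P.parts}}
    (h : p ∈ γ.1.sem) : γ = P.guardOf p :=
  (P.existsUnique p).choose_spec.2 γ h

variable (px) in
open Classical in
/-- The partition `{true}` (without parts if there are no products). -/
def trivial : GuardPartition px where
  parts := ({⊤} : Finset (Guard px)).filter fun γ => γ.sem.Nonempty
  sem_sup_eq := Set.eq_univ_of_forall fun p => (Guard.mem_sem_finsetSup _ _ p).2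
    ⟨⊤, by simp only [Finset.mem_filter, Finset.mem_singleton, true_and]
           exact ⟨p, by simp [Guard.sem_top]⟩, by simp [Guard.sem_top]⟩
  sem_nonempty γ hγ := (Finset.mem_filter.1 hγ).2
  sem_inter_eq γ₁ h₁ γ₂ h₂ hne := by
    simp only [Finset.mem_filter, Finset.mem_singleton] at h₁ h₂
    exact absurd (h₁.1.trans h₂.1.symm) hne

open Classical in
/-- The intersection `P₁ ∧ P₂`: all satisfiable `γ₁ ∧ γ₂` with `γ₁ ∈ P₁`, `γ₂ ∈ P₂`. -/
def inter (P₁ P₂ : GuardPartition px) : GuardPartition px where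
  parts := ((P₁.parts ×ˢ P₂.parts).image fun γ => γ.1 ⊓ γ.2).filter fun γ => γ.sem.Nonempty
  sem_sup_eq := Set.eq_univ_of_forall fun p => by
    have hp : p ∈ ((P₁.guardOf p).1 ⊓ (P₂.guardOf p).1).sem := by
      rw [Guard.sem_inf]; exact ⟨P₁.mem_guardOf p, P₂.mem_guardOf p⟩
    exact (Guard.mem_sem_finsetSup _ _ p).2 ⟨(P₁.guardOf p).1 ⊓ (P₂.guardOf p).1,
      Finset.mem_filter.2 ⟨Finset.mem_image.2 ⟨((P₁.guardOf p).1, (P₂.guardOf p).1),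
        Finset.mem_product.2 ⟨(P₁.guardOf p).2, (P₂.guardOf p).2⟩, rfl⟩, ⟨p, hp⟩⟩, hp⟩
  sem_nonempty γ hγ := (Finset.mem_filter.1 hγ).2
  sem_inter_eq := by
    intro γ hγ δ hδ hne
    simp only [Finset.mem_filter, Finset.mem_image, Finset.mem_product, Prod.exists] at hγ hδ
    obtain ⟨⟨γ₁, γ₂, ⟨h₁, h₂⟩, rfl⟩, -⟩ := hγ
    obtain ⟨⟨δ₁, δ₂, ⟨k₁, k₂⟩, rfl⟩, -⟩ := hδ
    refine Set.eq_empty_of_forall_notMem fun p hp => hne ?_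
    rw [Guard.sem_inf, Guard.sem_inf] at hp
    obtain ⟨⟨a, b⟩, c, d⟩ := hp
    have e₁ := (P₁.eq_guardOf (γ := ⟨γ₁, h₁⟩) a).trans (P₁.eq_guardOf (γ := ⟨δ₁, k₁⟩) c).symm
    have e₂ := (P₂.eq_guardOf (γ := ⟨γ₂, h₂⟩) b).trans (P₂.eq_guardOf (γ := ⟨δ₂, k₂⟩) d).symm
    rw [Subtype.mk.injEq] at e₁ e₂
    rw [e₁, e₂]

theorem exists_inf_eq (P₁ P₂ : GuardPartition px) (γ : {γ // γ ∈ (P₁.inter P₂).parts}) :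
    ∃ c : {γ // γ ∈ P₁.parts} × {γ // γ ∈ P₂.parts}, c.1.1 ⊓ c.2.1 = γ.1 := by
  classical
  have hγ := γ.2
  simp only [inter, Finset.mem_filter, Finset.mem_image, Finset.mem_product, Prod.exists] at hγ
  obtain ⟨⟨γ₁, γ₂, ⟨h₁, h₂⟩, h⟩, -⟩ := hγ
  exact ⟨⟨⟨γ₁, h₁⟩, ⟨γ₂, h₂⟩⟩, h⟩

/-- The pair `(γ₁, γ₂)` with `γ = γ₁ ∧ γ₂`, for `γ ∈ P₁ ∧ P₂`. -/
def components (P₁ P₂ : GuardPartition px) (γ : {γ // γ ∈ (P₁.inter P₂).parts}) :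
    {γ // γ ∈ P₁.parts} × {γ // γ ∈ P₂.parts} :=
  (exists_inf_eq P₁ P₂ γ).choose

theorem components_guardOf (P₁ P₂ : GuardPartition px) (p : px) :
    components P₁ P₂ ((P₁.inter P₂).guardOf p) = (P₁.guardOf p, P₂.guardOf p) := by
  have h := (exists_inf_eq P₁ P₂ ((P₁.inter P₂).guardOf p)).choose_spec
  have hp := (P₁.inter P₂).mem_guardOf p
  rw [← h, Guard.sem_inf] at hp
  exact Prod.ext (P₁.eq_guardOf hp.1) (P₂.eq_guardOf hp.2)

end GuardPartition

/-! ## Injective functions from guard partitions -/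

variable (px) in
/-- `GP px K`: the injective functions from guard partitions of `px` to `K`. -/
structure GP (K : Type*) where
  part : GuardPartition px
  toFun : {γ // γ ∈ part.parts} → K
  injective : Function.Injective toFun

variable {K : Type*}

/-- The semantic representation of `f`: its value at the unique guard satisfied by `p`. -/
def GP.sem (f : GP px K) (p : px) : K := f.toFun (f.part.guardOf p)

section Canon

variable (P : GuardPartition px) (f : {γ // γ ∈ P.parts} → K)

open Classical in
/-- The disjunction of the class of `γ` for the relation `γ₁ ∼ γ₂ ↔ f γ₁ = f γ₂` on `P`. -/
def classSup (γ : {γ // γ ∈ P.parts}) : Guard px :=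
  (P.parts.attach.filter fun δ => f δ = f γ).sup Subtype.val

theorem mem_classSup {γ : {γ // γ ∈ P.parts}} {p : px} :
    p ∈ (classSup P f γ).sem ↔ f (P.guardOf p) = f γ := by
  classical
  simp only [classSup, Guard.mem_sem_finsetSup, Finset.mem_filter, Finset.mem_attach, true_and]
  constructor
  · rintro ⟨δ, h, hp⟩
    rwa [← P.eq_guardOf hp]
  · exact fun h => ⟨_, h, P.mem_guardOf p⟩

theorem classSup_congr {γ δ : {γ // γ ∈ P.parts}} (h : f γ = f δ) :
    classSup P f γ = classSup P f δ :=
  Guard.sem_injective <| Set.ext fun p => by rw [mem_classSup, mem_classSup, h]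

open Classical in
/-- The partition underlying the canonicalization. -/
def canonPart : GuardPartition px where
  parts := P.parts.attach.image (classSup P f)
  sem_sup_eq := Set.eq_univ_of_forall fun p => (Guard.mem_sem_finsetSup _ _ p).2
    ⟨classSup P f (P.guardOf p), Finset.mem_image_of_mem _ (Finset.mem_attach _ _),
      (mem_classSup P f).2 rfl⟩
  sem_nonempty δ hδ := by
    obtain ⟨γ, -, rfl⟩ := Finset.mem_image.1 hδ
    obtain ⟨p, hp⟩ := P.sem_nonempty _ γ.2
    exact ⟨p, (mem_classSup P f).2 (by rw [← P.eq_guardOf hp])⟩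
  sem_inter_eq := by
    intro γ hγ δ hδ hne
    obtain ⟨γ, -, rfl⟩ := Finset.mem_image.1 hγ
    obtain ⟨δ, -, rfl⟩ := Finset.mem_image.1 hδ
    refine Set.eq_empty_of_forall_notMem fun p hp => hne ?_
    have h : f γ = f δ := ((mem_classSup P f).1 hp.1).symm.trans ((mem_classSup P f).1 hp.2)
    exact classSup_congr P f h

theorem exists_classSup_eq (δ : {γ // γ ∈ (canonPart P f).parts}) :
    ∃ γ, classSup P f γ = δ.1 := by
  classical
  obtain ⟨γ, -, h⟩ := Finset.mem_image.1 δ.2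
  exact ⟨γ, h⟩

/-- The canonicalization of `f : P → K`: the disjunction of each class is sent to the common
value of `f` on that class. -/
def canon : GP px K where
  part := canonPart P f
  toFun δ := f (exists_classSup_eq P f δ).choose
  injective δ₁ δ₂ h := by
    have h₁ := (exists_classSup_eq P f δ₁).choose_spec
    have h₂ := (exists_classSup_eq P f δ₂).choose_spec
    refine Subtype.ext (h₁.symm.trans ((classSup_congr P f h).trans h₂))

theorem sem_canon (p : px) : (canon P f).sem p = f (P.guardOf p) := by
  have h := (exists_classSup_eq P f ((canonPart P f).guardOf p)).choose_spec
  have hp := (canonPart P f).mem_guardOf p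
  rw [← h, mem_classSup] at hp
  exact hp.symm

end Canon

namespace GP

theorem sem_injective : Function.Injective (sem : GP px K → px → K) := by
  have key : ∀ f g : GP px K, f.sem = g.sem →
      ∀ γ (hγ : γ ∈ f.part.parts), ∃ hγ' : γ ∈ g.part.parts, f.toFun ⟨γ, hγ⟩ = g.toFun ⟨γ, hγ'⟩ := by
    intro f g h γ hγ
    have aux : ∀ (f : GP px K) (p q : px), q ∈ (f.part.guardOf p).1.sem ↔ f.sem q = f.sem p := by
      intro f p q
      constructor
      · intro hq
        rw [sem, sem, f.part.eq_guardOf hq]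
      · intro hq
        rw [← f.injective hq]
        exact f.part.mem_guardOf q
    obtain ⟨p, hp⟩ := f.part.sem_nonempty γ hγ
    have e := f.part.eq_guardOf (γ := ⟨γ, hγ⟩) hp
    have e' : γ = (g.part.guardOf p).1 := by
      have : γ = (f.part.guardOf p).1 := congrArg Subtype.val e
      rw [this]
      exact Guard.sem_injective (Set.ext fun q => by rw [aux, aux, h])
    refine ⟨e' ▸ (g.part.guardOf p).2, ?_⟩
    have e'' : (⟨γ, e' ▸ (g.part.guardOf p).2⟩ : {γ // γ ∈ g.part.parts}) = g.part.guardOf p :=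
      Subtype.ext e'
    rw [e, e'']
    exact congrFun h p
  rintro ⟨⟨P, _, _, _⟩, f, _⟩ ⟨⟨Q, _, _, _⟩, g, _⟩ h
  have k₁ := key _ _ h
  have k₂ := key _ _ h.symm
  simp only at k₁ k₂
  obtain rfl : P = Q := Finset.ext fun γ => ⟨fun hγ => (k₁ γ hγ).1, fun hγ => (k₂ γ hγ).1⟩
  obtain rfl : f = g := funext fun γ => (k₁ γ.1 γ.2).2
  rfl

/-- The constant function `{true} → K` with value `x`. -/
def const (x : K) : GP px K where
  part := GuardPartition.trivial px
  toFun _ := x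
  injective γ δ _ := by
    classical
    have hγ := γ.2
    have hδ := δ.2
    simp only [GuardPartition.trivial, Finset.mem_filter, Finset.mem_singleton] at hγ hδ
    exact Subtype.ext (hγ.1.trans hδ.1.symm)

theorem sem_const (x : K) (p : px) : (const x : GP px K).sem p = x := rfl

/-- The canonicalization of `γ₁ ∧ γ₂ ↦ op (f₁ γ₁) (f₂ γ₂)` on `P₁ ∧ P₂`. -/
def map₂ (op : K → K → K) (f₁ f₂ : GP px K) : GP px K :=
  canon (f₁.part.inter f₂.part) fun γ =>
    op (f₁.toFun (GuardPartition.components f₁.part f₂.part γ).1)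
      (f₂.toFun (GuardPartition.components f₁.part f₂.part γ).2)

theorem sem_map₂ (op : K → K → K) (f₁ f₂ : GP px K) (p : px) :
    (map₂ op f₁ f₂).sem p = op (f₁.sem p) (f₂.sem p) := by
  rw [map₂, sem_canon, GuardPartition.components_guardOf]
  rfl

instance [Zero K] : Zero (GP px K) := ⟨const 0⟩
instance [One K] : One (GP px K) := ⟨const 1⟩
instance [Add K] : Add (GP px K) := ⟨map₂ (· + ·)⟩
instance [Mul K] : Mul (GP px K) := ⟨map₂ (· * ·)⟩
instance [KStar K] : KStar (GP px K) := ⟨fun f => canon f.part fun γ => KStar.kstar (f.toFun γ)⟩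

theorem sem_zero [Zero K] (p : px) : (0 : GP px K).sem p = 0 := rfl

theorem sem_one [One K] (p : px) : (1 : GP px K).sem p = 1 := rfl

theorem sem_add [Add K] (f g : GP px K) (p : px) : (f + g).sem p = f.sem p + g.sem p :=
  sem_map₂ _ f g p

theorem sem_mul [Mul K] (f g : GP px K) (p : px) : (f * g).sem p = f.sem p * g.sem p :=
  sem_map₂ _ f g p

theorem sem_kstar [KStar K] (f : GP px K) (p : px) :
    (KStar.kstar f).sem p = KStar.kstar (f.sem p) :=
  sem_canon _ _ p

instance [Semiring K] : Semiring (GP px K) where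
  add_assoc _ _ _ := sem_injective <| funext fun _ => by simp only [sem_add, add_assoc]
  zero_add _ := sem_injective <| funext fun _ => by simp only [sem_add, sem_zero, zero_add]
  add_zero _ := sem_injective <| funext fun _ => by simp only [sem_add, sem_zero, add_zero]
  add_comm _ _ := sem_injective <| funext fun _ => by simp only [sem_add, add_comm]
  nsmul := nsmulRec
  left_distrib _ _ _ := sem_injective <| funext fun _ => by simp only [sem_add, sem_mul, mul_add]
  right_distrib _ _ _ := sem_injective <| funext fun _ => by simp only [sem_add, sem_mul, add_mul]
  zero_mul _ := sem_injective <| funext fun _ => by simp only [sem_mul, sem_zero, zero_mul]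
  mul_zero _ := sem_injective <| funext fun _ => by simp only [sem_mul, sem_zero, mul_zero]
  mul_assoc _ _ _ := sem_injective <| funext fun _ => by simp only [sem_mul, mul_assoc]
  one_mul _ := sem_injective <| funext fun _ => by simp only [sem_mul, sem_one, one_mul]
  mul_one _ := sem_injective <| funext fun _ => by simp only [sem_mul, sem_one, mul_one]

theorem sem_pow [Semiring K] (f : GP px K) (n : ℕ) (p : px) : (f ^ n).sem p = f.sem p ^ n := by
  induction n with
  | zero => simp only [pow_zero, sem_one]
  | succ n ih => simp only [pow_succ, sem_mul, ih]

/-- With its natural order `f ≤ g ↔ f + g = g`, `GP px K` is an idempotent semiring. -/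
instance [IdemSemiring K] : IdemSemiring (GP px K) :=
  IdemSemiring.ofSemiring fun f => sem_injective <| funext fun p => by rw [sem_add, add_idem]

theorem le_iff [IdemSemiring K] {f g : GP px K} : f ≤ g ↔ ∀ p, f.sem p ≤ g.sem p := by
  rw [← add_eq_right_iff_le, ← sem_injective.eq_iff, funext_iff]
  exact forall_congr' fun p => by rw [sem_add, add_eq_right_iff_le]

instance [StarContinuousKleeneAlgebra K] : StarContinuousKleeneAlgebra (GP px K) where
  isLUB_mul_kstar_mul f g h := by
    constructor
    · rintro _ ⟨n, rfl⟩
      refine le_iff.2 fun p => ?_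
      simp only [sem_mul, sem_kstar, sem_pow]
      exact (StarContinuousKleeneAlgebra.isLUB_mul_kstar_mul _ _ _).1 ⟨n, rfl⟩
    · intro u hu
      refine le_iff.2 fun p => ?_
      simp only [sem_mul, sem_kstar]
      refine (StarContinuousKleeneAlgebra.isLUB_mul_kstar_mul _ _ _).2 ?_
      rintro _ ⟨n, rfl⟩
      have := le_iff.1 (hu ⟨n, rfl⟩) p
      simpa only [sem_mul, sem_pow] using this

end GP

/-! ## Featured weighted automata -/

variable (px) in
/-- A featured weighted automaton over `K` and `px`, with set of states `S`. -/
abbrev FeaturedAutomaton (S K : Type*) := WeightedAutomaton S (GP px K)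

/-- The projection to the product `p`: each transition label `f` is replaced by `⟦f⟧(p)`. -/
def FeaturedAutomaton.proj {S : Type*} (F : FeaturedAutomaton px S K) (p : px) :
    WeightedAutomaton S K :=
  F.map fun f => f.sem p

end FWA

end

open FWA

namespace FWA

open Matrix

/-! ### Stars that commute with multiplication on both sides -/

section IdemSemiring

variable {R : Type*} [IdemSemiring R]

/-! Evaluation at a product `p` is a semiring homomorphism `GP px K → K` commuting with star, but a
homomorphism need not preserve the infinite suprema that define `M*`. The remedy is to write `M*` as
a finite expression in `+`, `*` and `kstar` of the entries of `M`. Homomorphisms preserve such an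
expression, so one matrix over `GP px K` evaluates to the star of the projected matrix for every `p`
simultaneously (`exists_isContinuousStar_map`).

The expression is built row by row. `M` is a sum of rank-one matrices, one for each row; denesting
`(a + b)* = a* (b a*)*` adds a row `b`, and `b a*` again has rank one, with `(c r)* = 1 + c (r c)*
r` needing only a star of a scalar. The induction runs on `IsContinuousStar`, not on mere suprema of
powers, because denesting uses that multiplication on both sides preserves the supremum.

Since the order of `GP px K` is pointwise, stars at all products give the star over `GP px K`
(`isMatrixStar_of_semHom`). Independently, entries of `M ^ n` are sums of weights of paths of length
`n`, so `α M* κ` is the reachability value over any idempotent semiring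
(`isReachabilityValue_of_isMatrixStar`). -/

theorem sum_le_iff_forall_le {ι : Type*} (s : Finset ι) (f : ι → R) (u : R) :
    ∑ i ∈ s, f i ≤ u ↔ ∀ i ∈ s, f i ≤ u := by
  classical
  induction s using Finset.induction_on with
  | empty => simp
  | insert a s ha ih => rw [Finset.sum_insert ha, add_le_iff, ih, Finset.forall_mem_insert]

/-- `s` is a star of `a` in the `*`-continuous sense: `x s y = ⨁ₙ x aⁿ y` for all `x`, `y`. -/
def IsContinuousStar (a s : R) : Prop :=
  ∀ x y u : R, x * s * y ≤ u ↔ ∀ n : ℕ, x * a ^ n * y ≤ u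

namespace IsContinuousStar

variable {a b s t : R}

theorem le_iff (h : IsContinuousStar a s) {u : R} : s ≤ u ↔ ∀ n : ℕ, a ^ n ≤ u := by
  simpa using h 1 1 u

theorem pow_le (h : IsContinuousStar a s) (n : ℕ) : a ^ n ≤ s :=
  h.le_iff.1 le_rfl n

theorem one_le (h : IsContinuousStar a s) : 1 ≤ s := by
  simpa using h.pow_le 0

theorem mul_le (h : IsContinuousStar a s) : a * s ≤ s := by
  have := (h a 1 s).2 fun n => by simpa [← pow_succ'] using h.pow_le (n + 1)
  simpa using this

/-- Denesting: `(a + b)* = a* (b a*)*`. -/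
theorem add (ha : IsContinuousStar a s) (hb : IsContinuousStar (b * s) t) :
    IsContinuousStar (a + b) (s * t) := by
  have pow_le (n : ℕ) : (a + b) ^ n ≤ s * t := by
    induction n with
    | zero => simpa using mul_le_mul' ha.one_le hb.one_le
    | succ n ih =>
      rw [pow_succ']
      refine (mul_le_mul_right ih _).trans ?_
      rw [add_mul, add_le_iff, ← mul_assoc, ← mul_assoc]
      refine ⟨mul_le_mul_left ha.mul_le _, hb.mul_le.trans ?_⟩
      simpa using mul_le_mul_left ha.one_le t
  -- A factor `s` may be inserted after the powers of `a + b`: continuity replaces it by `a ^ i`,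
  -- which `(a + b) ^ i` absorbs.
  have step (x y u : R) (h : ∀ m : ℕ, x * (a + b) ^ m * y ≤ u) (m : ℕ) :
      x * (a + b) ^ m * s * y ≤ u := by
    refine (ha _ _ _).2 fun i => ?_
    refine le_trans ?_ (h (m + i))
    rw [pow_add, ← mul_assoc]
    exact mul_le_mul_left (mul_le_mul_right (pow_le_pow_left' le_self_add i) _) _
  refine fun x y u => ⟨fun h n => ?_, fun h => ?_⟩
  · exact (mul_le_mul_left (mul_le_mul_right (pow_le n) x) y).trans h
  -- The bound must hold for all `m`: each factor `b * s` is removed by inserting `s` and enlarging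
  -- `b` to `a + b`, which raises `m` by one.
  · have key (n : ℕ) : ∀ m : ℕ, x * (a + b) ^ m * ((b * s) ^ n * y) ≤ u := by
      induction n with
      | zero => simpa using h
      | succ n ih =>
        intro m
        refine le_trans ?_ (step x _ u ih (m + 1))
        rw [pow_succ' (b * s), pow_succ (a + b)]
        simp only [mul_assoc]
        exact mul_le_mul_right (mul_le_mul_right
          (mul_le_mul_left (le_add_self) _) _) _
    rw [← mul_assoc]
    refine (hb _ _ _).2 fun n => ?_
    have := step x _ u (key n) 0
    simpa [mul_assoc] using this

end IsContinuousStar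

end IdemSemiring

theorem isContinuousStar_kstar {K : Type*} [StarContinuousKleeneAlgebra K] (a : K) :
    IsContinuousStar a (KStar.kstar a) := fun x y u => by
  rw [isLUB_le_iff (StarContinuousKleeneAlgebra.isLUB_mul_kstar_mul x a y), mem_upperBounds,
    Set.forall_mem_range]

/-! ### Stars of matrices -/

section Matrix

variable {S : Type*} [Fintype S]

theorem mul_vecMulVec_mul_apply {R : Type*} [Semiring R] (x y : Matrix S S R) (c r : S → R)
    (a : R) (i j : S) :
    (x * vecMulVec c (a • r) * y) i j = (x *ᵥ c) i * a * (r ᵥ* y) j := by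
  rw [mul_vecMulVec, vecMulVec_mul, smul_vecMul, vecMulVec_apply, Pi.smul_apply, smul_eq_mul,
    mul_assoc]

variable [DecidableEq S]

/-- Square matrices over an idempotent semiring, with the entrywise order. -/
abbrev matrixIdemSemiring (R : Type*) [IdemSemiring R] : IdemSemiring (Matrix S S R) :=
  IdemSemiring.ofSemiring fun M => by ext; exact add_idem _

attribute [local instance] matrixIdemSemiring

theorem matrix_le_iff {R : Type*} [IdemSemiring R] {M N : Matrix S S R} :
    M ≤ N ↔ ∀ i j, M i j ≤ N i j := by
  rw [← add_eq_right_iff_le, ← Matrix.ext_iff]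
  exact forall_congr' fun i => forall_congr' fun j => add_eq_right_iff_le

theorem IsContinuousStar.isMatrixStar {R : Type*} [IdemSemiring R] {M N : Matrix S S R}
    (h : IsContinuousStar M N) : IsMatrixStar M N := by
  intro i j
  refine ⟨?_, fun u hu => ?_⟩
  · rintro _ ⟨n, rfl⟩
    exact matrix_le_iff.1 (h.pow_le n) i j
  -- Multiplying by these matrix units isolates the entry `(i, j)`, so a bound on that entry becomes
  -- a matrix inequality; all other entries are `0` on both sides.
  · have := (h (single i i 1) (single j j 1) (single i j u)).2 fun n => ?_
    · simpa [single_mul_mul_single] using matrix_le_iff.1 this i j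
    · rw [single_mul_mul_single, matrix_le_iff]
      intro k l
      rw [single_apply, single_apply]
      split_ifs
      · simpa using hu ⟨n, rfl⟩
      · exact le_rfl

theorem vecMulVec_pow_succ {R : Type*} [Semiring R] (c r : S → R) (n : ℕ) :
    vecMulVec c r ^ (n + 1) = vecMulVec c ((r ⬝ᵥ c) ^ n • r) := by
  induction n with
  | zero => simp
  | succ n ih =>
    rw [pow_succ, ih, vecMulVec_mul_vecMulVec, smul_dotProduct, smul_eq_mul, ← pow_succ]

/-- The star of a matrix of rank one. -/
theorem isContinuousStar_vecMulVec {K : Type*} [StarContinuousKleeneAlgebra K] (c r : S → K) :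
    IsContinuousStar (vecMulVec c r) (1 + vecMulVec c (KStar.kstar (r ⬝ᵥ c) • r)) := by
  intro x y u
  rw [mul_add, add_mul, add_le_iff]
  have key : x * vecMulVec c (KStar.kstar (r ⬝ᵥ c) • r) * y ≤ u ↔
      ∀ n : ℕ, x * vecMulVec c r ^ (n + 1) * y ≤ u := by
    -- Entrywise, both sides have the form `(x c)ᵢ * _ * (r y)ⱼ`, with the star or a power of the
    -- scalar `r ⬝ᵥ c` in the middle. Continuity in `K` then applies.
    simp only [matrix_le_iff, vecMulVec_pow_succ, mul_vecMulVec_mul_apply]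
    simp only [isContinuousStar_kstar (r ⬝ᵥ c) _ _ _]
    exact ⟨fun h n i j => h i j n, fun h i j n => h n i j⟩
  rw [key]
  refine ⟨fun h n => ?_, fun h => ⟨by simpa using h 0, fun n => h (n + 1)⟩⟩
  cases n with
  | zero => simpa using h.1
  | succ n => exact h.2 n

/-- Every square matrix has a star, which is preserved by homomorphisms. -/
theorem exists_isContinuousStar_map {ι A K : Type*} [Semiring A] [KStar A]
    [StarContinuousKleeneAlgebra K] (f : ι → A →+* K)
    (hf : ∀ p x, f p (KStar.kstar x) = KStar.kstar (f p x)) (M : Matrix S S A) :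
    ∃ N : Matrix S S A, ∀ p, IsContinuousStar (M.map (f p)) (N.map (f p)) := by
  have key (X : Finset S) : ∃ N : Matrix S S A, ∀ p, IsContinuousStar
      ((∑ k ∈ X, vecMulVec (Pi.single k 1) (M k)).map (f p)) (N.map (f p)) := by
    induction X using Finset.induction_on with
    | empty =>
      -- The empty sum is `0`, whose only nonzero power is the zeroth.
      refine ⟨1, fun p x y u => ?_⟩
      simp only [Finset.sum_empty, Matrix.map_zero _ (map_zero (f p)),
        Matrix.map_one _ (map_zero (f p)) (map_one (f p))]
      refine ⟨fun h n => ?_, fun h => by simpa using h 0⟩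
      cases n with
      | zero => simpa using h
      | succ n => simp
    | insert k X hk ih =>
      obtain ⟨N, hN⟩ := ih
      set c : S → A := Pi.single k 1
      set r : S → A := M k ᵥ* N
      -- This is `a* (b a*)*`, where `N` is the star of the earlier rows `a` and `b = c (M k)` is
      -- the new row, so that `b * N = c r` has rank one.
      refine ⟨N * (1 + vecMulVec c (KStar.kstar (r ⬝ᵥ c) • r)), fun p => ?_⟩
      have hb : (vecMulVec c (M k)).map (f p) * N.map (f p) =
          vecMulVec (f p ∘ c) (f p ∘ r) := by
        rw [← Matrix.map_mul, vecMulVec_mul]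
        ext i j
        simp [vecMulVec_apply, r]
      have ht : (1 + vecMulVec c (KStar.kstar (r ⬝ᵥ c) • r)).map (f p) =
          1 + vecMulVec (f p ∘ c) (KStar.kstar ((f p ∘ r) ⬝ᵥ (f p ∘ c)) • (f p ∘ r)) := by
        rw [Matrix.map_add _ (map_add (f p)),
          Matrix.map_one _ (map_zero (f p)) (map_one (f p)), ← RingHom.map_dotProduct]
        ext i j
        simp [vecMulVec_apply, hf]
      rw [Finset.sum_insert hk, add_comm, Matrix.map_add _ (map_add (f p)), Matrix.map_mul, ht]
      refine (hN p).add ?_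
      rw [hb]
      exact isContinuousStar_vecMulVec _ _
  have hM : ∑ k, vecMulVec (Pi.single k 1) (M k) = M := by
    ext i j
    simp [Matrix.sum_apply, vecMulVec_apply, Pi.single_apply]
  simpa only [hM] using key Finset.univ

end Matrix

/-! ### Path weights and powers of the transition matrix -/

namespace WeightedAutomaton

variable {S K : Type*} [IdemSemiring K] (A : WeightedAutomaton S K)

theorem matrix_apply_le_iff {i j : S} {u : K} :
    A.matrix i j ≤ u ↔ ∀ x, (i, x, j) ∈ A.trans → x ≤ u := by
  classical
  simp only [matrix, sum_le_iff_forall_le, Finset.mem_filter]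
  constructor
  · exact fun h x hx => h _ ⟨hx, rfl, rfl⟩
  · rintro h ⟨i, x, j⟩ ⟨ht, rfl, rfl⟩
    exact h x ht

theorem mul_matrix_mul_le_iff {i j : S} {x y u : K} :
    x * A.matrix i j * y ≤ u ↔ ∀ z, (i, z, j) ∈ A.trans → x * z * y ≤ u := by
  classical
  simp only [matrix, Finset.mul_sum, Finset.sum_mul, sum_le_iff_forall_le, Finset.mem_filter]
  constructor
  · exact fun h z hz => h _ ⟨hz, rfl, rfl⟩
  · rintro h ⟨i, z, j⟩ ⟨ht, rfl, rfl⟩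
    exact h z ht

/-- Relabelling may merge transitions whose labels become equal. Idempotency makes this harmless:
both sums have the same upper bounds. -/
theorem matrix_map {L : Type*} [IdemSemiring L] (g : K →+* L) :
    (A.map g).matrix = A.matrix.map g := by
  classical
  ext i j
  refine eq_of_forall_ge_iff fun u => ?_
  rw [matrix_apply_le_iff, Matrix.map_apply, matrix, map_sum, sum_le_iff_forall_le]
  simp only [map, Finset.mem_image, Finset.mem_filter, Prod.mk.injEq]
  constructor
  · rintro h ⟨i, x, j⟩ ⟨ht, rfl, rfl⟩
    exact h _ ⟨_, ht, rfl, rfl, rfl⟩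
  · rintro h _ ⟨t, ht, rfl, rfl, rfl⟩
    exact h t ⟨ht, rfl, rfl⟩

theorem initVec_dotProduct_mulVec_accVec_le_iff [Fintype S] {N : Matrix S S K} {u : K} :
    A.initVec ⬝ᵥ (N *ᵥ A.accVec) ≤ u ↔ ∀ i ∈ A.init, ∀ j ∈ A.acc, N i j ≤ u := by
  classical
  simp only [dotProduct, Matrix.mulVec, initVec, accVec, Finset.mul_sum, sum_le_iff_forall_le,
    Finset.mem_univ, true_imp_iff]
  refine forall_congr' fun i => ?_
  by_cases hi : i ∈ A.init
  · simp only [hi, if_true, one_mul, true_imp_iff]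
    refine forall_congr' fun j => ?_
    by_cases hj : j ∈ A.acc <;> simp [hj]
  · simp [hi]

variable [Fintype S] [DecidableEq S]

variable {A} in
theorem IsPath.weight_le {i j : S} {π : List (S × K × S)} (h : A.IsPath i π j) :
    weight π ≤ (A.matrix ^ π.length) i j := by
  induction h with
  | nil s => simp [weight]
  | @cons s s' s'' x π ht _ ih =>
    rw [List.length_cons, pow_succ', Matrix.mul_apply]
    refine le_trans ?_ ((sum_le_iff_forall_le _ _ _).1 le_rfl s' (Finset.mem_univ _))
    exact mul_le_mul' (A.matrix_apply_le_iff.1 le_rfl x ht) ih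

/-- The prefix `x` carries the weight of the transitions already read, which lets the induction on
`n` peel off the first transition. -/
theorem mul_matrix_pow_le {j : S} {u : K} (n : ℕ) : ∀ (i : S) (x : K),
    (∀ π, A.IsPath i π j → x * weight π ≤ u) → x * (A.matrix ^ n) i j ≤ u := by
  induction n with
  | zero =>
    intro i x h
    rw [pow_zero, Matrix.one_apply]
    split_ifs with hij
    · subst hij
      simpa [weight] using h [] (.nil i)
    · simp
  | succ n ih =>
    intro i x h
    rw [pow_succ', Matrix.mul_apply, Finset.mul_sum, sum_le_iff_forall_le]
    intro k _
    rw [← mul_assoc, mul_matrix_mul_le_iff]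
    intro z hz
    refine ih k _ fun π hπ => ?_
    simpa [weight, mul_assoc] using h _ (.cons hz hπ)

/-- If the star of the transition matrix exists, then `α M* κ` is the reachability value. -/
theorem isReachabilityValue_of_isMatrixStar {N : Matrix S S K} (h : IsMatrixStar A.matrix N) :
    A.IsReachabilityValue (A.initVec ⬝ᵥ (N *ᵥ A.accVec)) := by
  constructor
  · rintro _ ⟨i, hi, j, hj, π, hπ, rfl⟩
    exact (hπ.weight_le.trans ((h i j).1 ⟨_, rfl⟩)).trans
      (A.initVec_dotProduct_mulVec_accVec_le_iff.1 le_rfl i hi j hj)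
  · intro u hu
    refine A.initVec_dotProduct_mulVec_accVec_le_iff.2 fun i hi j hj => (h i j).2 ?_
    rintro _ ⟨n, rfl⟩
    simpa using A.mul_matrix_pow_le n i 1 fun π hπ => by
      simpa using hu ⟨i, hi, j, hj, π, hπ, rfl⟩

end WeightedAutomaton

/-! ### Evaluation at a product -/

namespace GP

variable {N : Type*} {px : Set (Set N)} {K : Type*}

/-- Evaluation at a product, as a homomorphism of semirings. -/
noncomputable def semHom [Semiring K] (p : px) : GP px K →+* K where
  toFun f := f.sem p
  map_zero' := sem_zero p
  map_one' := sem_one p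
  map_add' f g := sem_add f g p
  map_mul' f g := sem_mul f g p

/-- The order is pointwise, so suprema at every product assemble to one in `GP px K`, provided that
an element `g` with these values is already at hand. -/
theorem isLUB_of_sem [IdemSemiring K] {ι : Type*} {f : ι → GP px K} {g : GP px K}
    (h : ∀ p, IsLUB (Set.range fun i => (f i).sem p) (g.sem p)) : IsLUB (Set.range f) g := by
  constructor
  · rintro _ ⟨i, rfl⟩
    exact le_iff.2 fun p => (h p).1 ⟨i, rfl⟩
  · intro u hu
    refine le_iff.2 fun p => (h p).2 ?_
    rintro _ ⟨i, rfl⟩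
    exact le_iff.1 (hu ⟨i, rfl⟩) p

end GP

theorem isMatrixStar_of_semHom {N : Type*} {px : Set (Set N)} {K S : Type*} [IdemSemiring K]
    [Fintype S] [DecidableEq S] {M Mstar : Matrix S S (GP px K)}
    (h : ∀ p, IsMatrixStar (M.map (GP.semHom p)) (Mstar.map (GP.semHom p))) :
    IsMatrixStar M Mstar := fun i j => GP.isLUB_of_sem fun p => by
  have := h p i j
  simp only [← Matrix.map_pow] at this
  exact this

end FWA

/-! ### The main theorem -/

open FWA
theorem theorem1 {N : Type*} (px : Set (Set N)) {K : Type*} [StarContinuousKleeneAlgebra K]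
    {S : Type*} [Fintype S] [DecidableEq S] (F : FeaturedAutomaton px S K) :
    ∃ v : GP px K,
      F.IsMatrixValue v ∧ F.IsReachabilityValue v ∧
      ∀ p : px, (F.proj p).IsReachabilityValue (v.sem p) := by
  obtain ⟨Mstar, h⟩ := exists_isContinuousStar_map (fun p : px => GP.semHom (K := K) p)
    (fun p x => GP.sem_kstar x p) F.matrix
  have hF : IsMatrixStar F.matrix Mstar := isMatrixStar_of_semHom fun p => (h p).isMatrixStar
  refine ⟨_, ⟨Mstar, hF, rfl⟩, F.isReachabilityValue_of_isMatrixStar hF, fun p => ?_⟩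
  -- Projecting the automaton and then forming its matrix agrees with evaluating the matrix of `F`
  -- at `p`.
  have hp : IsMatrixStar (F.proj p).matrix (Mstar.map (GP.semHom p)) := by
    have := (h p).isMatrixStar
    rwa [← WeightedAutomaton.matrix_map] at this
  -- What remains is that evaluation commutes with the finite expression `α M* κ`; the indicator
  -- vectors go to indicator vectors because `0` and `1` are preserved.
  convert (F.proj p).isReachabilityValue_of_isMatrixStar hp
  change GP.semHom p _ = _
  rw [RingHom.map_dotProduct]
  congr 1
  · ext i
    simp only [Function.comp, WeightedAutomaton.initVec, apply_ite (GP.semHom p), map_one,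
      map_zero]
    rfl
  · ext i
    simp only [Function.comp, RingHom.map_mulVec]
    congr 1
    ext j
    simp only [WeightedAutomaton.accVec, apply_ite (GP.semHom p), map_one, map_zero,
      Function.comp]
    rfl
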